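/- **Proposition (MI–Fisher relation).** Let $X$ be a random vector in $\mathbb R^n$ and, for each $t>0$, let $Y_t = X+Z_t$, where $Z_t\sim\mathcal N(\mathbf 0,t\mathbf I_n)$ is independent of $X$. Let $I(X;Y_t)\in[0,\infty]$ be the mutual information in nats, that is, the Kullback–Leibler divergence of the joint law of $(X,Y_t)$ from the product of the two marginal laws. For every $t>0$ the vector $Y_t$ has a unique continuous density $p_{Y_t}$ with respect to Lebesgue measure; it is strictly positive and continuously differentiable, and the Fisher information $$J(Y_t)=\mathbb E\bigl[\|\nabla\log p_{Y_t}(Y_t)\|^2\bigr]$$ is finite. Moreover: 1. If $I(X;Y_{t_0})<\infty$ for some $t_0>0$, then $I(X;Y_t)<\infty$ for all $t>0$, the function $t\mapsto I(X;Y_t)$ is differentiable on $(0,\infty)$, and for all $t>0$ $$\frac{d}{dt}I(X;Y_t)=\frac12 J(Y_t)-\frac{n}{2t}.$$ 2. If $\mathbb E\|X\|<\infty$, then $I(X;Y_t)<\infty$ for all $t>0$ (so that 1 applies), and $\mathrm{mmse}(t)=\mathbb E\bigl[\|X-\mathbb E[X\mid Y_t]\|^2\bigr]$ is finite and satisfies,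 for all $t>0$, $$\mathrm{mmse}(t)=nt-t^2J(Y_t).$$ -/

import Mathlib

open MeasureTheory ProbabilityTheory

noncomputable section

/-- `p` is a continuous probability density function (with respect to Lebesgue measure)
of the measure `ν` on `ℝⁿ`. -/
def IsContDensity {n : ℕ} (ν : Measure (EuclideanSpace ℝ (Fin n)))
    (p : EuclideanSpace ℝ (Fin n) → ℝ) : Prop :=
  Continuous p ∧ (∀ y, 0 ≤ p y) ∧ ν = volume.withDensity (fun y => ENNReal.ofReal (p y))

/-- A measure has at most one continuous density. -/
theorem IsContDensity.unique {n : ℕ} {ν : Measure (EuclideanSpace ℝ (Fin n))}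
    {p q : EuclideanSpace ℝ (Fin n) → ℝ} [IsFiniteMeasure ν]
    (hp : IsContDensity ν p) (hq : IsContDensity ν q) : p = q := by
  obtain ⟨hpc, hp0, hpν⟩ := hp
  obtain ⟨hqc, hq0, hqν⟩ := hq
  have hfin : ∫⁻ y, ENNReal.ofReal (p y) ≠ ⊤ := by
    have h1 : ν Set.univ ≠ ⊤ := measure_ne_top ν _
    rwa [hpν, withDensity_apply _ MeasurableSet.univ, Measure.restrict_univ] at h1
  have h := (withDensity_eq_iff (μ := volume) (by fun_prop) (by fun_prop) hfin).1
    (hpν.symm.trans hqν)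
  refine (hpc.ae_eq_iff_eq volume hqc).1 ?_
  filter_upwards [h] with y hy
  exact (ENNReal.ofReal_eq_ofReal_iff (hp0 y) (hq0 y)).1 hy

open Classical in
/-- The density `p_U` of a random vector `U` with law `ν`: the unique continuous density of `ν`
(and `0` if there is none). -/
def density {n : ℕ} (ν : Measure (EuclideanSpace ℝ (Fin n))) : EuclideanSpace ℝ (Fin n) → ℝ :=
  if h : ∃ p, IsContDensity ν p then h.choose else 0

/-- The score function `∇ log p_U`, in terms of the law `ν` of `U`. -/
def score {n : ℕ} (ν : Measure (EuclideanSpace ℝ (Fin n))) (y : EuclideanSpace ℝ (Fin n)) :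
    EuclideanSpace ℝ (Fin n) :=
  gradient (fun u => Real.log (density ν u)) y

/-- The Fisher information `J(U) = E ‖∇ log p_U(U)‖²` of a random vector `U`. -/
def fisherInfo {Ω : Type*} [MeasurableSpace Ω] {n : ℕ} (U : Ω → EuclideanSpace ℝ (Fin n))
    (P : Measure Ω) : ENNReal :=
  ∫⁻ y, ‖score (P.map U) y‖ₑ ^ 2 ∂(P.map U)

/-- The mutual information `I(X;Y)` in nats: the Kullback-Leibler divergence of the joint law of
`X` and `Y` from the product of their laws. -/
def mutualInfo {Ω A B : Type*} [MeasurableSpace Ω] [MeasurableSpace A] [MeasurableSpace B]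
    (X : Ω → A) (Y : Ω → B) (P : Measure Ω) : ENNReal :=
  InformationTheory.klDiv (P.map (fun ω => (X ω, Y ω))) ((P.map X).prod (P.map Y))

/-- The minimum mean-square error `E ‖X - E[X | Y]‖²`. -/
def mmse {Ω : Type*} [MeasurableSpace Ω] {n : ℕ} (X Y : Ω → EuclideanSpace ℝ (Fin n))
    (P : Measure Ω) : ENNReal :=
  ∫⁻ ω, ‖X ω - (P[X | MeasurableSpace.comap Y inferInstance]) ω‖ₑ ^ 2 ∂P

end

/-! Use the scale `a = (√t)⁻¹` and write the output as `x + a⁻¹ • z`, with `z` standard Gaussian. Up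
to a constant factor the output density is `outMass`, written K_a(y), the mean over the input of
exp(-‖a(y - x)‖²/2). The log-likelihood ratio of the joint law against the product law is -‖a(y -
x)‖²/2 - log K_a(y). The first term has mean -n/2 at every scale, so the information is E[-log
K_a(Y)] - n/2 (`toReal_klDiv_jointLaw`).

This expectation is differentiated at fixed input and fixed `z`, under a law that does not depend on
`a`. Let W = a(Y - X), with posterior mean m = `noiseMean` and posterior second moment S =
`noiseSq`. The pointwise derivative is a⁻¹(S(Y) - ⟨z, m(Y)⟩), and its mean is a⁻¹(n - E‖m(Y)‖²) by
conditioning on the output. Tweedie's formula (`gradient_log_outMass`) says that the score is -a m,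
hence J = a² E‖m(Y)‖². The chain rule for a = t^(-1/2) then gives the derivative in t.

No moment of the input is assumed, so domination comes from the information density itself. Jensen
gives S ≤ -2 log K_a (`noiseSq_le`), and `neg_log_outMass_line_le` bounds -log K_b on a whole range
of scales by its value at the largest one. Finiteness passes between scales by
`integrable_log_outMass_of_integrable`. For integrable inputs it holds by comparing the output
density with a polynomially decaying one.

For the MMSE, X - E[X | Y] = -a⁻¹(W - m(Y)), and Pythagoras gives a⁻²(n - E‖m(Y)‖²). -/

noncomputable section GaussianChannel

open Real Filter Topology

set_option linter.unusedSectionVars false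

variable {E : Type*} [NormedAddCommGroup E] [InnerProductSpace ℝ E]
  [FiniteDimensional ℝ E] [MeasurableSpace E] [BorelSpace E]

/-! ### Density and second moment of the standard Gaussian. -/

variable (E) in
/-- The normalizing constant of the standard Gaussian density on `E`. -/
def gaussConst : ℝ := ((2 * π) ^ ((Module.finrank ℝ E : ℝ) / 2))⁻¹

lemma gaussConst_pos : 0 < gaussConst E := by
  unfold gaussConst; positivity

lemma integrable_exp_neg_sq_norm : Integrable (fun z : E => rexp (-‖z‖ ^ 2 / 2)) := by
  have h := (GaussianFourier.integrable_cexp_neg_mul_sq_norm_add (V := E) (b := 1 / 2)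
    (by norm_num) 0 0).norm
  refine h.congr (ae_of_all _ fun z => ?_)
  simp only [Complex.norm_exp]
  congr 1
  simp [← Complex.ofReal_pow]
  ring

/-- The standard Gaussian measure has the usual density with respect to Lebesgue measure. -/
theorem stdGaussian_eq_withDensity :
    stdGaussian E = volume.withDensity
      (fun z => ENNReal.ofReal (gaussConst E * rexp (-‖z‖ ^ 2 / 2))) := by
  have hint := (integrable_exp_neg_sq_norm (E := E)).const_mul (gaussConst E)
  have : IsFiniteMeasure (volume.withDensity
      (fun z : E => ENNReal.ofReal (gaussConst E * rexp (-‖z‖ ^ 2 / 2)))) :=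
    isFiniteMeasure_withDensity_ofReal hint.2
  apply Measure.ext_of_charFun
  ext t
  rw [charFun_stdGaussian, charFun_apply, integral_withDensity_eq_integral_toReal_smul
    (by fun_prop) (by simp)]
  have h := GaussianFourier.integral_cexp_neg_mul_sq_norm_add (V := E) (b := 1 / 2)
    (by norm_num) Complex.I t
  have e : ∀ z : E, (ENNReal.ofReal (gaussConst E * rexp (-‖z‖ ^ 2 / 2))).toReal •
      Complex.exp (↑(inner ℝ z t) * Complex.I) = (gaussConst E : ℂ) *
      Complex.exp (-(1 / 2 : ℂ) * ↑‖z‖ ^ 2 + Complex.I * ↑(inner ℝ t z)) := by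
    intro z
    have := (gaussConst_pos (E := E)).le
    rw [ENNReal.toReal_ofReal (by positivity), Complex.exp_add, real_inner_comm, Complex.real_smul]
    push_cast
    rw [mul_comm Complex.I]
    ring_nf
  simp_rw [e]
  rw [integral_const_mul, h]
  have hc : (gaussConst E : ℂ) * (↑π / (1 / 2 : ℂ)) ^ ((Module.finrank ℝ E : ℂ) / 2) = 1 := by
    have : (↑π / (1 / 2 : ℂ)) ^ ((Module.finrank ℝ E : ℂ) / 2) =
        (((2 * π) ^ ((Module.finrank ℝ E : ℝ) / 2) : ℝ) : ℂ) := by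
      rw [Complex.ofReal_cpow (by positivity)]
      push_cast
      congr 1
      ring
    rw [this, gaussConst, ← Complex.ofReal_mul, inv_mul_cancel₀ (by positivity)]
    simp
  rw [← mul_assoc, hc, one_mul]
  congr 1
  rw [Complex.I_sq]
  ring

lemma integrable_sq_norm_stdGaussian : Integrable (fun z : E => ‖z‖ ^ 2) (stdGaussian E) :=
  (IsGaussian.memLp_two_id (μ := stdGaussian E)).integrable_norm_pow (by norm_num)

lemma integral_sq_norm_stdGaussian :
    ∫ z : E, ‖z‖ ^ 2 ∂stdGaussian E = Module.finrank ℝ E := by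
  let b := stdOrthonormalBasis ℝ E
  have hL : ∀ i, MemLp (fun z : E => inner ℝ (b i) z) 2 (stdGaussian E) := fun i =>
    (innerSL ℝ (b i)).comp_memLp' IsGaussian.memLp_two_id
  have h1 : ∀ i, ∫ z : E, inner ℝ (b i) z ^ 2 ∂stdGaussian E = 1 := by
    intro i
    have := variance_dual_stdGaussian (innerSL ℝ (b i))
    rw [variance_of_integral_eq_zero (by fun_prop) (integral_strongDual_stdGaussian _)] at this
    simpa using this
  have h2 : ∀ z : E, ‖z‖ ^ 2 = ∑ i, inner ℝ (b i) z ^ 2 := fun z =>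
    (b.sum_sq_inner_right z).symm
  simp_rw [h2]
  rw [integral_finsetSum _ fun i _ => (hL i).integrable_sq]
  simp [h1]

/-! ### The Gaussian channel: joint law, output density, posterior. -/

/-- Exponent of the Gaussian kernel with scale `a⁻¹` between `x` and `y`. -/
def gaussExp (a : ℝ) (x y : E) : ℝ := -‖a • (y - x)‖ ^ 2 / 2

/-- The unnormalized density at `y` of the output of the Gaussian channel with input law `μ` and
noise of standard deviation `a⁻¹`. -/
def outMass (μ : Measure E) (a : ℝ) (y : E) : ℝ := ∫ x, rexp (gaussExp a x y) ∂μ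

/-- The joint law of the input and the output of the Gaussian channel with input law `μ` and
noise of standard deviation `a⁻¹`. -/
def jointLaw (μ : Measure E) (a : ℝ) : Measure (E × E) :=
  (μ.prod (stdGaussian E)).map (fun p => (p.1, p.1 + a⁻¹ • p.2))

/-- The law of the output of the Gaussian channel with input law `μ` and
noise of standard deviation `a⁻¹`. -/
def outLaw (μ : Measure E) (a : ℝ) : Measure E := (jointLaw μ a).map Prod.snd

variable (E) in
/-- The normalizing constant of the Gaussian density with standard deviation `a⁻¹`. -/
def scaledConst (a : ℝ) : ℝ := gaussConst E * a ^ Module.finrank ℝ E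

lemma scaledConst_pos {a : ℝ} (ha : 0 < a) : 0 < scaledConst E a :=
  mul_pos gaussConst_pos (by positivity)

lemma gaussExp_nonpos (a : ℝ) (x y : E) : gaussExp a x y ≤ 0 := by
  unfold gaussExp
  have : 0 ≤ ‖a • (y - x)‖ ^ 2 := by positivity
  linarith

@[fun_prop]
lemma Continuous.gaussExp {T : Type*} [TopologicalSpace T] {a : T → ℝ} {x y : T → E}
    (ha : Continuous a) (hx : Continuous x) (hy : Continuous y) :
    Continuous fun p => gaussExp (a p) (x p) (y p) := by
  unfold _root_.gaussExp
  fun_prop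

@[fun_prop]
lemma Measurable.gaussExp {T : Type*} [MeasurableSpace T] {a : T → ℝ} {x y : T → E}
    (ha : Measurable a) (hx : Measurable x) (hy : Measurable y) :
    Measurable fun p => gaussExp (a p) (x p) (y p) := by
  unfold _root_.gaussExp
  fun_prop

lemma integrable_exp_gaussExp (μ : Measure E) [IsFiniteMeasure μ] (a : ℝ) (y : E) :
    Integrable (fun x => rexp (gaussExp a x y)) μ := by
  refine (integrable_const (1 : ℝ)).mono' (by fun_prop) (ae_of_all _ fun x => ?_)
  rw [norm_of_nonneg (exp_pos _).le]
  exact exp_le_one_iff.2 (gaussExp_nonpos a x y)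

variable (μ : Measure E) [IsProbabilityMeasure μ]

lemma outMass_pos (a : ℝ) (y : E) : 0 < outMass μ a y :=
  integral_exp_pos (integrable_exp_gaussExp μ a y)

/-- The benefit of leaving out the normalizing constant: `-log (outMass μ a y)` is nonnegative, so
it can itself serve as a dominating function. -/
lemma outMass_le_one (a : ℝ) (y : E) : outMass μ a y ≤ 1 := by
  have h := integral_mono (integrable_exp_gaussExp μ a y) (integrable_const (1 : ℝ))
    (fun x => exp_le_one_iff.2 (gaussExp_nonpos a x y))
  simpa [outMass] using h

@[fun_prop]
lemma Measurable.outMass {T : Type*} [MeasurableSpace T] {a : T → ℝ} {y : T → E}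
    (ha : Measurable a) (hy : Measurable y) : Measurable fun p => outMass μ (a p) (y p) := by
  unfold _root_.outMass
  have h : StronglyMeasurable (fun p : T × E => rexp (_root_.gaussExp (a p.1) p.2 (y p.1))) :=
    Measurable.stronglyMeasurable (by fun_prop)
  exact h.integral_prod_right.measurable

lemma lintegral_comp_add_smul {a : ℝ} (ha : 0 < a) (x : E) {f : E → ENNReal} (hf : Measurable f) :
    ∫⁻ z, f (x + a⁻¹ • z) = ENNReal.ofReal (a ^ Module.finrank ℝ E) * ∫⁻ y, f y := by
  have h := Measure.map_addHaar_smul (volume : Measure E) (inv_ne_zero ha.ne')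
  have h2 : ∫⁻ z, f (x + a⁻¹ • z) = ∫⁻ u, f (x + u) ∂(volume.map fun z : E => a⁻¹ • z) := by
    rw [lintegral_map (by fun_prop) (by fun_prop)]
  rw [h2, h, lintegral_smul_measure, lintegral_add_left_eq_self]
  congr 2
  rw [abs_of_nonneg (by positivity), inv_pow, inv_inv]

variable {μ} in
lemma lintegral_jointLaw {a : ℝ} (ha : 0 < a) {f : E × E → ENNReal}
    (hf : Measurable f) :
    ∫⁻ p, f p ∂jointLaw μ a =
      ∫⁻ p, ENNReal.ofReal (scaledConst E a * rexp (gaussExp a p.1 p.2)) * f p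
        ∂μ.prod volume := by
  rw [jointLaw, lintegral_map hf (by fun_prop), lintegral_prod _ (by fun_prop),
    lintegral_prod _ (by fun_prop)]
  congr with x
  rw [stdGaussian_eq_withDensity, lintegral_withDensity_eq_lintegral_mul _ (by fun_prop)
    (by fun_prop)]
  have e : ∀ z : E, ENNReal.ofReal (gaussConst E * rexp (-‖z‖ ^ 2 / 2)) *
      f (x, x + a⁻¹ • z) = (fun y => ENNReal.ofReal (gaussConst E *
        rexp (gaussExp a x y)) * f (x, y)) (x + a⁻¹ • z) := by
    intro z
    simp [gaussExp, smul_smul, ha.ne']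
  simp only [Pi.mul_apply, e]
  refine (lintegral_comp_add_smul ha x (f := fun y => ENNReal.ofReal (gaussConst E *
    rexp (gaussExp a x y)) * f (x, y)) (by fun_prop)).trans ?_
  rw [← lintegral_const_mul _ (by fun_prop)]
  congr with y
  rw [← mul_assoc, ← ENNReal.ofReal_mul (by positivity), scaledConst]
  congr 2
  ring

lemma jointLaw_eq_withDensity {a : ℝ} (ha : 0 < a) :
    jointLaw μ a = (μ.prod volume).withDensity
      (fun p => ENNReal.ofReal (scaledConst E a * rexp (gaussExp a p.1 p.2))) := by
  refine Measure.ext_of_lintegral _ fun f hf => ?_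
  rw [lintegral_jointLaw ha hf, lintegral_withDensity_eq_lintegral_mul _ (by fun_prop) hf]
  rfl

instance (a : ℝ) : IsProbabilityMeasure (jointLaw μ a) :=
  Measure.isProbabilityMeasure_map (by fun_prop)

instance (a : ℝ) : IsProbabilityMeasure (outLaw μ a) :=
  Measure.isProbabilityMeasure_map (by fun_prop)

lemma outLaw_eq_withDensity {a : ℝ} (ha : 0 < a) :
    outLaw μ a = volume.withDensity (fun y => ENNReal.ofReal (scaledConst E a * outMass μ a y)) := by
  refine Measure.ext_of_lintegral _ fun f hf => ?_
  rw [outLaw, lintegral_map hf measurable_snd, lintegral_jointLaw ha (by fun_prop),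
    lintegral_prod_symm _ (by fun_prop), lintegral_withDensity_eq_lintegral_mul _ (by fun_prop) hf]
  congr with y
  dsimp only [Pi.mul_apply]
  rw [lintegral_mul_const _ (by fun_prop), outMass, ← integral_const_mul,
    ofReal_integral_eq_lintegral_ofReal ((integrable_exp_gaussExp μ a y).const_mul _)]
  have := (scaledConst_pos (E := E) ha).le
  exact ae_of_all _ fun x => by simp; positivity

/-- The inputPosterior law of the input of the Gaussian channel, given the output `y`. -/
def inputPosterior (μ : Measure E) (a : ℝ) (y : E) : Measure E := μ.tilted (fun x => gaussExp a x y)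

instance (a : ℝ) (y : E) : IsProbabilityMeasure (inputPosterior μ a y) :=
  isProbabilityMeasure_tilted (integrable_exp_gaussExp μ a y)

variable {F : Type*} [NormedAddCommGroup F] [NormedSpace ℝ F]

lemma integral_posterior (a : ℝ) (y : E) (h : E → F) :
    ∫ x, h x ∂inputPosterior μ a y =
      (outMass μ a y)⁻¹ • ∫ x, rexp (gaussExp a x y) • h x ∂μ := by
  rw [inputPosterior, integral_tilted, ← integral_smul]
  congr with x
  rw [smul_smul, outMass, div_eq_inv_mul]

lemma outMass_smul_integral_posterior (a : ℝ) (y : E) (h : E → F) :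
    outMass μ a y • ∫ x, h x ∂inputPosterior μ a y = ∫ x, rexp (gaussExp a x y) • h x ∂μ := by
  rw [integral_posterior, smul_smul, mul_inv_cancel₀ (outMass_pos μ a y).ne', one_smul]

lemma integrable_smul_of_integrable_jointLaw {a : ℝ} (ha : 0 < a) {h : E × E → F}
    (hh : Integrable h (jointLaw μ a)) :
    Integrable (fun p : E × E => (scaledConst E a * rexp (gaussExp a p.1 p.2)) • h p)
      (μ.prod volume) := by
  rw [jointLaw_eq_withDensity μ ha, integrable_withDensity_iff_integrable_smul' (by fun_prop)
    (by simp)] at hh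
  refine hh.congr (ae_of_all _ fun p => ?_)
  have := (scaledConst_pos (E := E) ha).le
  simp only
  rw [ENNReal.toReal_ofReal (by positivity)]

lemma integral_outLaw_eq {a : ℝ} (ha : 0 < a) (f : E → F) :
    ∫ y, f y ∂outLaw μ a = ∫ y, (scaledConst E a * outMass μ a y) • f y := by
  rw [outLaw_eq_withDensity μ ha, integral_withDensity_eq_integral_toReal_smul
    (by fun_prop) (by simp)]
  congr with y
  rw [ENNReal.toReal_ofReal (mul_nonneg (scaledConst_pos ha).le (outMass_pos μ a y).le)]

lemma integrable_outLaw_iff {a : ℝ} (ha : 0 < a) (f : E → F) :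
    Integrable f (outLaw μ a) ↔
      Integrable (fun y => (scaledConst E a * outMass μ a y) • f y) := by
  rw [outLaw_eq_withDensity μ ha, integrable_withDensity_iff_integrable_smul' (by fun_prop)
    (by simp)]
  refine integrable_congr (ae_of_all _ fun y => ?_)
  simp only
  rw [ENNReal.toReal_ofReal (mul_nonneg (scaledConst_pos ha).le (outMass_pos μ a y).le)]

/-- Disintegration of the joint law along the output: integrability. -/
lemma integrable_integral_posterior {a : ℝ} (ha : 0 < a) {h : E × E → F}
    (hh : Integrable h (jointLaw μ a)) :
    Integrable (fun y => ∫ x, h (x, y) ∂inputPosterior μ a y) (outLaw μ a) := by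
  rw [integrable_outLaw_iff μ ha]
  refine (integrable_smul_of_integrable_jointLaw μ ha hh).integral_prod_right.congr
    (ae_of_all _ fun y => ?_)
  simp only [mul_smul]
  rw [integral_smul, outMass_smul_integral_posterior]

/-- Disintegration of the joint law along the output. -/
lemma integral_integral_posterior {a : ℝ} (ha : 0 < a) {h : E × E → F}
    (hh : Integrable h (jointLaw μ a)) :
    ∫ y, ∫ x, h (x, y) ∂inputPosterior μ a y ∂outLaw μ a = ∫ p, h p ∂jointLaw μ a := by
  have h1 : ∫ p, h p ∂jointLaw μ a = ∫ p : E × E,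
      (scaledConst E a * rexp (gaussExp a p.1 p.2)) • h p ∂μ.prod volume := by
    rw [jointLaw_eq_withDensity μ ha, integral_withDensity_eq_integral_toReal_smul
      (by fun_prop) (by simp)]
    congr with p
    have := (scaledConst_pos (E := E) ha).le
    rw [ENNReal.toReal_ofReal (by positivity)]
  rw [h1, integral_prod_symm _ (integrable_smul_of_integrable_jointLaw μ ha hh),
    integral_outLaw_eq μ ha]
  congr with y
  simp only [mul_smul]
  rw [integral_smul, outMass_smul_integral_posterior]

end GaussianChannel

/-! ### Mutual information through `outMass`, and posterior moments of the noise. -/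

noncomputable section GaussianChannelPosterior

open Real Filter Topology

set_option linter.unusedSectionVars false

variable {E : Type*} [NormedAddCommGroup E] [InnerProductSpace ℝ E]
  [FiniteDimensional ℝ E] [MeasurableSpace E] [BorelSpace E]
  (μ : Measure E) [IsProbabilityMeasure μ]

/-- The normalized noise is standard Gaussian. -/
lemma map_noise_jointLaw {a : ℝ} (ha : 0 < a) :
    (jointLaw μ a).map (fun p => a • (p.2 - p.1)) = stdGaussian E := by
  rw [jointLaw, Measure.map_map (by fun_prop) (by fun_prop)]
  have : ((fun p : E × E => a • (p.2 - p.1)) ∘ fun p : E × E => (p.1, p.1 + a⁻¹ • p.2)) =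
      Prod.snd := by
    ext p
    simp [smul_smul, ha.ne']
  rw [this, Measure.map_snd_prod]
  simp

lemma integrable_sq_noise {a : ℝ} (ha : 0 < a) :
    Integrable (fun p : E × E => ‖a • (p.2 - p.1)‖ ^ 2) (jointLaw μ a) := by
  have h := integrable_sq_norm_stdGaussian (E := E)
  rw [← map_noise_jointLaw μ ha] at h
  exact h.comp_measurable (by fun_prop)

lemma integral_sq_noise {a : ℝ} (ha : 0 < a) :
    ∫ p : E × E, ‖a • (p.2 - p.1)‖ ^ 2 ∂jointLaw μ a = Module.finrank ℝ E := by
  have h := integral_sq_norm_stdGaussian (E := E)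
  rw [← map_noise_jointLaw μ ha, integral_map (by fun_prop) (by fun_prop)] at h
  exact h

/-- Bayes' rule: the normalizing constant occurs in both the joint and the output density and
cancels. -/
lemma jointLaw_eq_withDensity_prod {a : ℝ} (ha : 0 < a) :
    jointLaw μ a = (μ.prod (outLaw μ a)).withDensity
      (fun p => ENNReal.ofReal (rexp (gaussExp a p.1 p.2) / outMass μ a p.2)) := by
  rw [outLaw_eq_withDensity μ ha, prod_withDensity_right (by fun_prop),
    ← withDensity_mul _ (by fun_prop) (by fun_prop), jointLaw_eq_withDensity μ ha]
  congr with p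
  have h1 := (scaledConst_pos (E := E) ha).le
  have h2 := outMass_pos μ a p.2
  rw [Pi.mul_apply, ← ENNReal.ofReal_mul (by positivity)]
  congr 1
  field_simp

lemma jointLaw_absolutelyContinuous {a : ℝ} (ha : 0 < a) :
    jointLaw μ a ≪ μ.prod (outLaw μ a) := by
  rw [jointLaw_eq_withDensity_prod μ ha]
  exact withDensity_absolutelyContinuous _ _

lemma llr_jointLaw {a : ℝ} (ha : 0 < a) :
    llr (jointLaw μ a) (μ.prod (outLaw μ a)) =ᵐ[jointLaw μ a]
      fun p => gaussExp a p.1 p.2 - log (outMass μ a p.2) := by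
  have h := Measure.rnDeriv_withDensity (μ.prod (outLaw μ a))
    (f := fun p => ENNReal.ofReal (rexp (gaussExp a p.1 p.2) / outMass μ a p.2)) (by fun_prop)
  rw [← jointLaw_eq_withDensity_prod μ ha] at h
  filter_upwards [(jointLaw_absolutelyContinuous μ ha).ae_le h] with p hp
  have h2 := outMass_pos μ a p.2
  rw [llr, hp, ENNReal.toReal_ofReal (by positivity), log_div (exp_pos _).ne' h2.ne', log_exp]

lemma integrable_comp_snd_jointLaw_iff {F : Type*} [NormedAddCommGroup F] {a : ℝ} {f : E → F}
    (hf : AEStronglyMeasurable f (outLaw μ a)) :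
    Integrable (fun p : E × E => f p.2) (jointLaw μ a) ↔ Integrable f (outLaw μ a) :=
  (integrable_map_measure hf measurable_snd.aemeasurable).symm

lemma integral_comp_snd_jointLaw {F : Type*} [NormedAddCommGroup F] [NormedSpace ℝ F] {a : ℝ}
    {f : E → F} (hf : AEStronglyMeasurable f (outLaw μ a)) :
    ∫ p : E × E, f p.2 ∂jointLaw μ a = ∫ y, f y ∂outLaw μ a :=
  (integral_map measurable_snd.aemeasurable hf).symm

lemma measurable_log_outMass (a : ℝ) : Measurable fun y => log (outMass μ a y) :=
  measurable_log.comp (by fun_prop)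

lemma integrable_gaussExp_jointLaw {a : ℝ} (ha : 0 < a) :
    Integrable (fun p : E × E => gaussExp a p.1 p.2) (jointLaw μ a) :=
  (integrable_sq_noise μ ha).neg.div_const 2

/-- The noise energy is always integrable, so only the `log (outMass μ a y)` part of the
log-likelihood ratio can fail to be. -/
theorem klDiv_jointLaw_ne_top_iff {a : ℝ} (ha : 0 < a) :
    InformationTheory.klDiv (jointLaw μ a) (μ.prod (outLaw μ a)) ≠ ⊤ ↔
      Integrable (fun y => log (outMass μ a y)) (outLaw μ a) := by
  rw [InformationTheory.klDiv_ne_top_iff, integrable_congr (llr_jointLaw μ ha),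
    and_iff_right (jointLaw_absolutelyContinuous μ ha),
    ← integrable_comp_snd_jointLaw_iff μ (measurable_log_outMass μ a).aestronglyMeasurable]
  have h := integrable_gaussExp_jointLaw μ ha
  refine ⟨fun h' => (h.sub h').congr (ae_of_all _ fun p => by simp), fun h' => h.sub h'⟩

theorem toReal_klDiv_jointLaw {a : ℝ} (ha : 0 < a)
    (hint : Integrable (fun y => log (outMass μ a y)) (outLaw μ a)) :
    (InformationTheory.klDiv (jointLaw μ a) (μ.prod (outLaw μ a))).toReal =
      (∫ y, -log (outMass μ a y) ∂outLaw μ a) - Module.finrank ℝ E / 2 := by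
  rw [InformationTheory.toReal_klDiv_of_measure_eq (jointLaw_absolutelyContinuous μ ha) (by simp),
    integral_congr_ae (llr_jointLaw μ ha), integral_sub (integrable_gaussExp_jointLaw μ ha)
    ((integrable_comp_snd_jointLaw_iff μ (measurable_log_outMass μ a).aestronglyMeasurable).2 hint),
    integral_comp_snd_jointLaw μ (measurable_log_outMass μ a).aestronglyMeasurable]
  have : ∫ p : E × E, gaussExp a p.1 p.2 ∂jointLaw μ a = -(Module.finrank ℝ E) / 2 := by
    simp only [gaussExp]
    rw [integral_div, integral_neg, integral_sq_noise μ ha]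
  rw [this, integral_neg]
  ring

/-- The posterior mean of the normalized noise, given the output `y`. -/
def noiseMean (μ : Measure E) (a : ℝ) (y : E) : E := ∫ x, a • (y - x) ∂inputPosterior μ a y

/-- The posterior second moment of the normalized noise, given the output `y`. -/
def noiseSq (μ : Measure E) (a : ℝ) (y : E) : ℝ :=
  ∫ x, ‖a • (y - x)‖ ^ 2 ∂inputPosterior μ a y

/-- From s + 1 ≤ exp s with s = ‖a(y - x)‖²/2. The bound is uniform in all variables, so posterior
noise moments up to order two exist for every input law. -/
lemma exp_mul_sq_norm_le (a : ℝ) (x y : E) :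
    rexp (gaussExp a x y) * ‖a • (y - x)‖ ^ 2 ≤ 2 := by
  have h := add_one_le_exp (‖a • (y - x)‖ ^ 2 / 2)
  have h2 : rexp (gaussExp a x y) * rexp (‖a • (y - x)‖ ^ 2 / 2) = 1 := by
    rw [← exp_add, gaussExp, neg_div, neg_add_cancel, exp_zero]
  nlinarith [exp_pos (gaussExp a x y)]

lemma exp_mul_norm_le (a : ℝ) (x y : E) :
    rexp (gaussExp a x y) * ‖a • (y - x)‖ ≤ 2 := by
  have h := exp_mul_sq_norm_le a x y
  have h1 : rexp (gaussExp a x y) ≤ 1 := exp_le_one_iff.2 (gaussExp_nonpos a x y)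
  nlinarith [exp_pos (gaussExp a x y), sq_nonneg (‖a • (y - x)‖ - 1)]

lemma integrable_exp_smul_noise (a : ℝ) (y : E) :
    Integrable (fun x => rexp (gaussExp a x y) • (a • (y - x))) μ := by
  refine (integrable_const (2 : ℝ)).mono' (by fun_prop) (ae_of_all _ fun x => ?_)
  rw [norm_smul, norm_of_nonneg (exp_pos _).le]
  exact exp_mul_norm_le a x y

lemma integrable_exp_smul_sq_noise (a : ℝ) (y : E) :
    Integrable (fun x => rexp (gaussExp a x y) • ‖a • (y - x)‖ ^ 2) μ := by
  refine (integrable_const (2 : ℝ)).mono' (by fun_prop) (ae_of_all _ fun x => ?_)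
  rw [norm_of_nonneg (by simp; positivity)]
  exact exp_mul_sq_norm_le a x y

lemma integrable_noise_posterior (a : ℝ) (y : E) :
    Integrable (fun x => a • (y - x)) (inputPosterior μ a y) :=
  (integrable_tilted_iff (integrable_exp_gaussExp μ a y) _).2 (integrable_exp_smul_noise μ a y)

lemma integrable_sq_noise_posterior (a : ℝ) (y : E) :
    Integrable (fun x => ‖a • (y - x)‖ ^ 2) (inputPosterior μ a y) :=
  (integrable_tilted_iff (integrable_exp_gaussExp μ a y) _).2
    (integrable_exp_smul_sq_noise μ a y)

lemma measurable_noiseMean (a : ℝ) : Measurable (noiseMean μ a) := by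
  unfold noiseMean
  simp_rw [integral_posterior]
  have h : StronglyMeasurable
      (fun p : E × E => rexp (gaussExp a p.2 p.1) • (a • (p.1 - p.2))) :=
    Measurable.stronglyMeasurable (by fun_prop)
  have := h.integral_prod_right' (ν := μ)
  exact (by fun_prop : Measurable fun y => (outMass μ a y)⁻¹).smul this.measurable

lemma measurable_noiseSq (a : ℝ) : Measurable (noiseSq μ a) := by
  unfold noiseSq
  simp_rw [integral_posterior]
  have h : StronglyMeasurable
      (fun p : E × E => rexp (gaussExp a p.2 p.1) • ‖a • (p.1 - p.2)‖ ^ 2) :=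
    Measurable.stronglyMeasurable (by fun_prop)
  have := h.integral_prod_right' (ν := μ)
  exact (by fun_prop : Measurable fun y => (outMass μ a y)⁻¹).smul this.measurable

lemma noiseSq_nonneg (a : ℝ) (y : E) : 0 ≤ noiseSq μ a y :=
  integral_nonneg fun _ => by positivity

/-- Nonnegativity of the posterior variance, obtained by integrating ⟨m, w⟩ ≤ (‖m‖² + ‖w‖²)/2 over
the posterior. -/
lemma sq_norm_noiseMean_le (a : ℝ) (y : E) : ‖noiseMean μ a y‖ ^ 2 ≤ noiseSq μ a y := by
  have h1 : ‖noiseMean μ a y‖ ^ 2 =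
      ∫ x, inner ℝ (noiseMean μ a y) (a • (y - x)) ∂inputPosterior μ a y := by
    rw [integral_inner (integrable_noise_posterior μ a y), ← noiseMean,
      real_inner_self_eq_norm_sq]
  have h2 : ∫ x, inner ℝ (noiseMean μ a y) (a • (y - x)) ∂inputPosterior μ a y ≤
      ∫ x, (‖noiseMean μ a y‖ ^ 2 + ‖a • (y - x)‖ ^ 2) / 2 ∂inputPosterior μ a y := by
    refine integral_mono ((integrable_noise_posterior μ a y).const_inner _)
      (((integrable_const _).add (integrable_sq_noise_posterior μ a y)).div_const 2) fun x => ?_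
    have := real_inner_le_norm (noiseMean μ a y) (a • (y - x))
    dsimp only
    nlinarith [sq_nonneg (‖noiseMean μ a y‖ - ‖a • (y - x)‖)]
  rw [integral_div, integral_add (integrable_const _) (integrable_sq_noise_posterior μ a y),
    integral_const, ← noiseSq] at h2
  simp only [probReal_univ, one_smul] at h2
  linarith

/-- The posterior energy of the noise is controlled by the information density. -/
lemma noiseSq_le (a : ℝ) (y : E) : noiseSq μ a y ≤ 2 * -log (outMass μ a y) := by
  have hK := outMass_pos μ a y
  -- The exponential moment of order 1/2 exactly cancels the tilting, so its posterior mean is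
  -- `(outMass μ a y)⁻¹`. Jensen for exp then yields the factor 2.
  have hone : ∀ x : E, rexp (gaussExp a x y) • rexp (‖a • (y - x)‖ ^ 2 / 2) = 1 := fun x => by
    rw [smul_eq_mul, ← exp_add, gaussExp, neg_div, neg_add_cancel, exp_zero]
  have hi : Integrable (fun x => rexp (‖a • (y - x)‖ ^ 2 / 2)) (inputPosterior μ a y) := by
    refine (integrable_tilted_iff (integrable_exp_gaussExp μ a y) _).2 ?_
    simp_rw [hone]
    exact integrable_const _
  have h := convexOn_exp.map_integral_le (μ := inputPosterior μ a y)
    (f := fun x => ‖a • (y - x)‖ ^ 2 / 2) continuous_exp.continuousOn isClosed_univ (by simp)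
    ((integrable_sq_noise_posterior μ a y).div_const 2) hi
  rw [integral_div, ← noiseSq, integral_posterior] at h
  simp_rw [hone] at h
  simp only [integral_const, probReal_univ, smul_eq_mul, mul_one] at h
  have := (le_log_iff_exp_le (by positivity)).2 h
  rw [log_inv] at this
  linarith

lemma integrable_noiseSq {a : ℝ} (ha : 0 < a) : Integrable (noiseSq μ a) (outLaw μ a) :=
  integrable_integral_posterior μ ha (integrable_sq_noise μ ha)

lemma integral_noiseSq {a : ℝ} (ha : 0 < a) :
    ∫ y, noiseSq μ a y ∂outLaw μ a = Module.finrank ℝ E :=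
  (integral_integral_posterior μ ha (integrable_sq_noise μ ha)).trans (integral_sq_noise μ ha)

lemma integrable_sq_noiseMean {a : ℝ} (ha : 0 < a) :
    Integrable (fun y => ‖noiseMean μ a y‖ ^ 2) (outLaw μ a) := by
  refine (integrable_noiseSq μ ha).mono'
    ((measurable_noiseMean μ a).norm.pow_const 2).aestronglyMeasurable (ae_of_all _ fun y => ?_)
  rw [norm_of_nonneg (by positivity)]
  exact sq_norm_noiseMean_le μ a y

lemma integrable_inner_noise {a : ℝ} (ha : 0 < a) :
    Integrable (fun p : E × E => inner ℝ (a • (p.2 - p.1)) (noiseMean μ a p.2))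
      (jointLaw μ a) := by
  have hm := measurable_noiseMean μ a
  have h1 := (integrable_comp_snd_jointLaw_iff μ (integrable_sq_noiseMean μ ha).1).2
    (integrable_sq_noiseMean μ ha)
  refine ((integrable_sq_noise μ ha).add h1).mono' ?_ (ae_of_all _ fun p => ?_)
  · exact Measurable.aestronglyMeasurable (by fun_prop)
  · have := abs_real_inner_le_norm (a • (p.2 - p.1)) (noiseMean μ a p.2)
    rw [Real.norm_eq_abs, Pi.add_apply]
    nlinarith [sq_nonneg (‖a • (p.2 - p.1)‖ - ‖noiseMean μ a p.2‖)]

/-- Tower property: given the output, the noise may be replaced by its posterior mean. -/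
lemma integral_inner_noise {a : ℝ} (ha : 0 < a) :
    ∫ p : E × E, inner ℝ (a • (p.2 - p.1)) (noiseMean μ a p.2) ∂jointLaw μ a =
      ∫ y, ‖noiseMean μ a y‖ ^ 2 ∂outLaw μ a := by
  rw [← integral_integral_posterior μ ha (integrable_inner_noise μ ha)]
  congr with y
  simp only
  simp_rw [real_inner_comm]
  rw [integral_inner (integrable_noise_posterior μ a y), ← noiseMean, real_inner_self_eq_norm_sq]

end GaussianChannelPosterior

/-! ### Comparison of scales, and the derivative of the information. -/

noncomputable section GaussianChannelInformation

open Real Filter Topology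

set_option linter.unusedSectionVars false

variable {E : Type*} [NormedAddCommGroup E] [InnerProductSpace ℝ E]
  [FiniteDimensional ℝ E] [MeasurableSpace E] [BorelSpace E]
  (μ : Measure E) [IsProbabilityMeasure μ]

lemma neg_log_outMass_nonneg (a : ℝ) (y : E) : 0 ≤ -log (outMass μ a y) :=
  neg_nonneg.2 (log_nonpos (outMass_pos μ a y).le (outMass_le_one μ a y))

lemma gaussExp_line {a : ℝ} (ha : 0 < a) (x' x z : E) :
    gaussExp a x' (x + a⁻¹ • z) = -‖z + a • (x - x')‖ ^ 2 / 2 := by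
  have : a • (x + a⁻¹ • z - x') = z + a • (x - x') := by
    rw [add_sub_right_comm, smul_add, smul_smul, mul_inv_cancel₀ ha.ne', one_smul, add_comm]
  rw [gaussExp, this]

/-- The right side minus the left is ‖z + (b - a)v‖² + 2a(b - a)‖v‖². -/
lemma sq_norm_add_smul_le {a b : ℝ} (ha : 0 < a) (hab : a ≤ b) (z v : E) :
    ‖z + a • v‖ ^ 2 ≤ ‖z + b • v‖ ^ 2 + ‖z‖ ^ 2 := by
  have h : 0 ≤ ‖z + (b - a) • v‖ ^ 2 := by positivity
  rw [norm_add_sq_real, norm_smul, inner_smul_right, mul_pow, Real.norm_eq_abs, sq_abs] at *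
  rw [norm_add_sq_real, norm_smul, inner_smul_right, mul_pow, Real.norm_eq_abs, sq_abs]
  have h2 : 0 ≤ 2 * a * (b - a) * ‖v‖ ^ 2 := by
    have := sub_nonneg.2 hab
    positivity
  nlinarith

/-- At fixed input and normalized noise, the information density at a smaller scale is controlled
by that at a larger scale. -/
lemma neg_log_outMass_line_le {a b : ℝ} (ha : 0 < a) (hab : a ≤ b) (x z : E) :
    -log (outMass μ a (x + a⁻¹ • z)) ≤ -log (outMass μ b (x + b⁻¹ • z)) + ‖z‖ ^ 2 / 2 := by
  have hb := ha.trans_le hab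
  have h : rexp (-‖z‖ ^ 2 / 2) * outMass μ b (x + b⁻¹ • z) ≤ outMass μ a (x + a⁻¹ • z) := by
    rw [outMass, ← integral_const_mul]
    refine integral_mono ((integrable_exp_gaussExp μ b _).const_mul _)
      (integrable_exp_gaussExp μ a _) fun x' => ?_
    simp only
    rw [← exp_add, exp_le_exp, gaussExp_line hb, gaussExp_line ha]
    linarith [sq_norm_add_smul_le ha hab z (x - x')]
  have h2 := log_le_log (mul_pos (exp_pos _) (outMass_pos μ b _)) h
  rw [log_mul (exp_pos _).ne' (outMass_pos μ b _).ne', log_exp] at h2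
  linarith

lemma gaussExp_eq_mul {a : ℝ} (ha : 0 < a) (b : ℝ) (x y : E) :
    gaussExp b x y = gaussExp a x y * (b / a) ^ 2 := by
  simp only [gaussExp, norm_smul, mul_pow, Real.norm_eq_abs, sq_abs]
  field_simp

lemma outMass_le_outMass {a b : ℝ} (ha : 0 < a) (hab : a ≤ b) (y : E) :
    outMass μ b y ≤ outMass μ a y := by
  refine integral_mono (integrable_exp_gaussExp μ b y) (integrable_exp_gaussExp μ a y) fun x => ?_
  simp only [exp_le_exp]
  rw [gaussExp_eq_mul ha b]
  have h1 : 1 ≤ (b / a) ^ 2 := one_le_pow₀ ((one_le_div ha).2 hab)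
  nlinarith [gaussExp_nonpos a x y]

/-- The information densities at the same output at two scales are comparable. -/
lemma neg_log_outMass_le {a b : ℝ} (ha : 0 < a) (hab : a ≤ b) (y : E) :
    -log (outMass μ b y) ≤ (b / a) ^ 2 * -log (outMass μ a y) := by
  have h1 : 1 ≤ (b / a) ^ 2 := one_le_pow₀ ((one_le_div ha).2 hab)
  have e : ∀ x, rexp (gaussExp a x y) ^ ((b / a) ^ 2) = rexp (gaussExp b x y) := fun x => by
    rw [← exp_mul, gaussExp_eq_mul ha b]
  -- The kernel at scale `b` is the kernel at scale `a` to the power (b/a)² ≥ 1, so Jensen applies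
  -- to that power.
  have h := (convexOn_rpow h1).map_integral_le (μ := μ) (f := fun x => rexp (gaussExp a x y))
    (continuousOn_id.rpow_const fun x _ => Or.inr (by positivity)) isClosed_Ici
    (ae_of_all _ fun x => (exp_pos _).le) (integrable_exp_gaussExp μ a y)
    ((integrable_exp_gaussExp μ b y).congr (ae_of_all _ fun x => (e x).symm))
  simp only [e] at h
  have h2 := log_le_log (rpow_pos_of_pos (outMass_pos μ a y) _) (show outMass μ a y ^ ((b / a) ^ 2) ≤
    outMass μ b y from h)
  rw [log_rpow (outMass_pos μ a y)] at h2
  linarith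

lemma outLaw_eq_map (a : ℝ) :
    outLaw μ a = (μ.prod (stdGaussian E)).map (fun p => p.1 + a⁻¹ • p.2) := by
  rw [outLaw, jointLaw, Measure.map_map (by fun_prop) (by fun_prop)]
  rfl

lemma integrable_log_line_iff (a : ℝ) :
    Integrable (fun p : E × E => log (outMass μ a (p.1 + a⁻¹ • p.2))) (μ.prod (stdGaussian E)) ↔
      Integrable (fun y => log (outMass μ a y)) (outLaw μ a) := by
  rw [outLaw_eq_map, integrable_map_measure (measurable_log_outMass μ a).aestronglyMeasurable
    (by fun_prop)]
  rfl

lemma integrable_sq_norm_snd :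
    Integrable (fun p : E × E => ‖p.2‖ ^ 2) (μ.prod (stdGaussian E)) :=
  integrable_sq_norm_stdGaussian.comp_snd μ

/-- Towards more noise, the comparison is made at fixed input and normalized noise. -/
lemma integrable_log_outMass_of_ge {a b : ℝ} (ha : 0 < a) (hab : a ≤ b)
    (h : Integrable (fun y => log (outMass μ b y)) (outLaw μ b)) :
    Integrable (fun y => log (outMass μ a y)) (outLaw μ a) := by
  rw [← integrable_log_line_iff] at h ⊢
  refine (h.neg.add ((integrable_sq_norm_snd μ).div_const 2)).mono'
    ((measurable_log_outMass μ a).comp (by fun_prop)).aestronglyMeasurable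
    (ae_of_all _ fun p => ?_)
  rw [Real.norm_eq_abs, ← abs_neg, abs_of_nonneg (neg_log_outMass_nonneg μ a _)]
  exact neg_log_outMass_line_le μ ha hab p.1 p.2

/-- Towards less noise, the comparison is made at a fixed output: `outMass` decreases in the scale,
so the change of output law costs only the ratio of the constants. -/
lemma integrable_log_outMass_of_le {a b : ℝ} (ha : 0 < a) (hab : a ≤ b)
    (h : Integrable (fun y => log (outMass μ a y)) (outLaw μ a)) :
    Integrable (fun y => log (outMass μ b y)) (outLaw μ b) := by
  have hb := ha.trans_le hab
  rw [integrable_outLaw_iff μ ha] at h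
  rw [integrable_outLaw_iff μ hb]
  have hm := measurable_log_outMass μ b
  refine (h.norm.const_mul (scaledConst E b / scaledConst E a * (b / a) ^ 2)).mono'
    (Measurable.aestronglyMeasurable (by fun_prop)) (ae_of_all _ fun y => ?_)
  have hA := scaledConst_pos (E := E) ha
  have hB := scaledConst_pos (E := E) hb
  have hKa := outMass_pos μ a y
  have hKb := outMass_pos μ b y
  rw [norm_smul, norm_smul, norm_of_nonneg (mul_pos hB hKb).le, norm_of_nonneg (mul_pos hA hKa).le,
    ← norm_neg (log (outMass μ b y)), ← norm_neg (log (outMass μ a y)),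
    norm_of_nonneg (neg_log_outMass_nonneg μ b y), norm_of_nonneg (neg_log_outMass_nonneg μ a y)]
  have h1 := neg_log_outMass_le μ ha hab y
  have h2 := outMass_le_outMass μ ha hab y
  have h3 := neg_log_outMass_nonneg μ b y
  calc scaledConst E b * outMass μ b y * -log (outMass μ b y)
      ≤ scaledConst E b * outMass μ a y * ((b / a) ^ 2 * -log (outMass μ a y)) := by gcongr
    _ = _ := by field_simp

/-- Finiteness of the output entropy does not depend on the scale. -/
lemma integrable_log_outMass_of_integrable {a b : ℝ} (ha : 0 < a) (hb : 0 < b)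
    (h : Integrable (fun y => log (outMass μ a y)) (outLaw μ a)) :
    Integrable (fun y => log (outMass μ b y)) (outLaw μ b) := by
  rcases le_total a b with hab | hab
  · exact integrable_log_outMass_of_le μ ha hab h
  · exact integrable_log_outMass_of_ge μ hb hab h

/-- With w = z + a(x - x'), the noise that a candidate input `x'` would need, x - x' = a⁻¹(w - z).
This turns the derivative of the exponent along the line into noise moments, free of moments of the
input. -/
lemma inner_noise_line {a : ℝ} (ha : 0 < a) (x' x z : E) :
    inner ℝ (z + a • (x - x')) (x - x') =
      a⁻¹ * (‖a • (x + a⁻¹ • z - x')‖ ^ 2 - inner ℝ z (a • (x + a⁻¹ • z - x'))) := by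
  have e : a • (x + a⁻¹ • z - x') = z + a • (x - x') := by
    rw [add_sub_right_comm, smul_add, smul_smul, mul_inv_cancel₀ ha.ne', one_smul, add_comm]
  have e2 : x - x' = a⁻¹ • ((z + a • (x - x')) - z) := by
    rw [add_sub_cancel_left, smul_smul, inv_mul_cancel₀ ha.ne', one_smul]
  rw [e]
  generalize z + a • (x - x') = w at *
  rw [e2, inner_smul_right, inner_sub_right, real_inner_self_eq_norm_sq, real_inner_comm]

lemma hasDerivAt_exp_line (b : ℝ) (x' x z : E) :
    HasDerivAt (fun b : ℝ => rexp (-‖z + b • (x - x')‖ ^ 2 / 2))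
      (rexp (-‖z + b • (x - x')‖ ^ 2 / 2) * -inner ℝ (z + b • (x - x')) (x - x')) b := by
  have h1 : HasDerivAt (fun b : ℝ => z + b • (x - x')) (x - x') b := by
    simpa using ((hasDerivAt_id b).smul_const (x - x')).const_add z
  have h2 := ((h1.norm_sq).neg.div_const 2).exp
  refine h2.congr_deriv ?_
  simp only [Pi.neg_apply]
  ring

lemma hasDerivAt_outMass_line {a : ℝ} (ha : 0 < a) (x z : E) :
    HasDerivAt (fun b => outMass μ b (x + b⁻¹ • z))
      (-(a⁻¹ * (outMass μ a (x + a⁻¹ • z) *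
        (noiseSq μ a (x + a⁻¹ • z) - inner ℝ z (noiseMean μ a (x + a⁻¹ • z)))))) a := by
  have hs : Set.Ioi (a / 2) ∈ 𝓝 a := Ioi_mem_nhds (by linarith)
  have hd := (hasDerivAt_integral_of_dominated_loc_of_deriv_le (μ := μ)
    (F := fun b x' => rexp (-‖z + b • (x - x')‖ ^ 2 / 2))
    (F' := fun b x' => rexp (-‖z + b • (x - x')‖ ^ 2 / 2) *
      -inner ℝ (z + b • (x - x')) (x - x'))
    -- The two 2's are the uniform bounds on kernel times ‖w‖² and kernel times ‖w‖; `(a / 2)⁻¹`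
    -- bounds `b⁻¹`.
    (bound := fun _ => (a / 2)⁻¹ * (2 + 2 * ‖z‖)) hs
    (Eventually.of_forall fun b => by fun_prop) ?_
    (by fun_prop) (ae_of_all _ fun x' b hb => ?_) (integrable_const _)
    (ae_of_all _ fun x' b hb => hasDerivAt_exp_line b x' x z)).2
  · have e1 : ∀ x', rexp (-‖z + a • (x - x')‖ ^ 2 / 2) * -inner ℝ (z + a • (x - x')) (x - x') =
        -(a⁻¹ * (rexp (gaussExp a x' (x + a⁻¹ • z)) • ‖a • (x + a⁻¹ • z - x')‖ ^ 2 -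
          inner ℝ z (rexp (gaussExp a x' (x + a⁻¹ • z)) • (a • (x + a⁻¹ • z - x'))))) := by
      intro x'
      rw [inner_noise_line ha, gaussExp_line ha, inner_smul_right _ _ (rexp _), smul_eq_mul]
      ring
    have e2 : ∫ x', rexp (-‖z + a • (x - x')‖ ^ 2 / 2) *
        -inner ℝ (z + a • (x - x')) (x - x') ∂μ = -(a⁻¹ * (outMass μ a (x + a⁻¹ • z) *
        (noiseSq μ a (x + a⁻¹ • z) - inner ℝ z (noiseMean μ a (x + a⁻¹ • z))))) := by
      simp_rw [e1]
      rw [integral_neg, integral_const_mul, integral_sub (integrable_exp_smul_sq_noise μ a _)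
        ((integrable_exp_smul_noise μ a _).const_inner z),
        integral_inner (integrable_exp_smul_noise μ a _), ← outMass_smul_integral_posterior,
        ← outMass_smul_integral_posterior, ← noiseSq, ← noiseMean, inner_smul_right, smul_eq_mul]
      ring
    rw [e2] at hd
    refine hd.congr_of_eventuallyEq ?_
    filter_upwards [Ioi_mem_nhds ha] with b hb
    simp_rw [outMass, gaussExp_line hb]
  · refine (integrable_exp_gaussExp μ a (x + a⁻¹ • z)).congr (ae_of_all _ fun x' => ?_)
    simp only [gaussExp_line ha]
  · have hb' : a / 2 < b := hb
    have hb0 : 0 < b := by linarith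
    have h1 := exp_mul_sq_norm_le b x' (x + b⁻¹ • z)
    have h2 := exp_mul_norm_le b x' (x + b⁻¹ • z)
    rw [inner_noise_line hb0, ← gaussExp_line hb0]
    have h3 := abs_real_inner_le_norm z (b • (x + b⁻¹ • z - x'))
    generalize b • (x + b⁻¹ • z - x') = w at *
    have h4 := exp_pos (gaussExp b x' (x + b⁻¹ • z))
    generalize rexp (gaussExp b x' (x + b⁻¹ • z)) = e at *
    have h5 : |‖w‖ ^ 2 - inner ℝ z w| ≤ ‖w‖ ^ 2 + ‖z‖ * ‖w‖ :=
      (abs_sub _ _).trans (by rw [abs_of_nonneg (sq_nonneg ‖w‖)]; gcongr)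
    rw [norm_mul, norm_neg, norm_mul, norm_of_nonneg h4.le, norm_of_nonneg (by positivity),
      Real.norm_eq_abs]
    calc e * (b⁻¹ * |‖w‖ ^ 2 - inner ℝ z w|) ≤ e * (b⁻¹ * (‖w‖ ^ 2 + ‖z‖ * ‖w‖)) := by gcongr
      _ = b⁻¹ * (e * ‖w‖ ^ 2 + e * ‖w‖ * ‖z‖) := by ring
      _ ≤ (a / 2)⁻¹ * (2 + 2 * ‖z‖) := by gcongr

/-- The derivative of the information density at fixed input and normalized noise. -/
lemma hasDerivAt_neg_log_outMass_line {a : ℝ} (ha : 0 < a) (x z : E) :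
    HasDerivAt (fun b => -log (outMass μ b (x + b⁻¹ • z)))
      (a⁻¹ * (noiseSq μ a (x + a⁻¹ • z) - inner ℝ z (noiseMean μ a (x + a⁻¹ • z)))) a := by
  have hK := outMass_pos μ a (x + a⁻¹ • z)
  refine ((hasDerivAt_outMass_line μ ha x z).log hK.ne').neg.congr_deriv ?_
  generalize x + a⁻¹ • z = y at *
  field_simp

/-- By |⟨z, m⟩| ≤ (‖z‖² + ‖m‖²)/2 and ‖m‖² ≤ S, the left side is at most 3S/2 + ‖z‖²/2, and S ≤ -2
log K. -/
lemma abs_noiseSq_sub_inner_le (a : ℝ) (y z : E) :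
    |noiseSq μ a y - inner ℝ z (noiseMean μ a y)| ≤ 3 * -log (outMass μ a y) + ‖z‖ ^ 2 / 2 := by
  have h1 := noiseSq_le μ a y
  have h2 := sq_norm_noiseMean_le μ a y
  have h3 := abs_real_inner_le_norm z (noiseMean μ a y)
  have h4 := noiseSq_nonneg μ a y
  have h5 := abs_sub (noiseSq μ a y) (inner ℝ z (noiseMean μ a y))
  rw [abs_of_nonneg h4] at h5
  nlinarith [sq_nonneg (‖z‖ - ‖noiseMean μ a y‖)]

/-- The derivative, with respect to the scale, of the expected information density. -/
theorem hasDerivAt_integral_neg_log_outMass {a : ℝ} (ha : 0 < a)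
    (hint : ∀ b, 0 < b → Integrable (fun y => log (outMass μ b y)) (outLaw μ b)) :
    HasDerivAt (fun b => ∫ y, -log (outMass μ b y) ∂outLaw μ b)
      (a⁻¹ * (Module.finrank ℝ E - ∫ y, ‖noiseMean μ a y‖ ^ 2 ∂outLaw μ a)) a := by
  -- The lower end controls `b⁻¹`; the upper end is the scale whose information density dominates
  -- all the others.
  have hs : Set.Ioo (a / 2) (2 * a) ∈ 𝓝 a := Ioo_mem_nhds (by linarith) (by linarith)
  have hlog : ∀ b, Measurable fun p : E × E => log (outMass μ b (p.1 + b⁻¹ • p.2)) := fun b =>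
    (measurable_log_outMass μ b).comp (by fun_prop)
  have hm1 := measurable_noiseSq μ a
  have hm2 := measurable_noiseMean μ a
  have hd := (hasDerivAt_integral_of_dominated_loc_of_deriv_le (μ := μ.prod (stdGaussian E))
    (F := fun b p => -log (outMass μ b (p.1 + b⁻¹ • p.2)))
    (F' := fun b p => b⁻¹ * (noiseSq μ b (p.1 + b⁻¹ • p.2) -
      inner ℝ p.2 (noiseMean μ b (p.1 + b⁻¹ • p.2))))
    -- The coefficient of ‖z‖² is 3 · 1/2 from the change of scale to `2 * a`, plus 1/2 from
    -- `abs_noiseSq_sub_inner_le`.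
    (bound := fun p => (a / 2)⁻¹ * (3 * -log (outMass μ (2 * a) (p.1 + (2 * a)⁻¹ • p.2)) +
      2 * ‖p.2‖ ^ 2)) hs
    (Eventually.of_forall fun b => (hlog b).neg.aestronglyMeasurable)
    ((integrable_log_line_iff μ a).2 (hint a ha)).neg
    (Measurable.aestronglyMeasurable (by fun_prop))
    (ae_of_all _ fun p b hb => ?_)
    (((((integrable_log_line_iff μ (2 * a)).2 (hint (2 * a) (by positivity))).neg.const_mul
      3).add ((integrable_sq_norm_snd μ).const_mul 2)).const_mul _)
    (ae_of_all _ fun p b hb => hasDerivAt_neg_log_outMass_line μ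
      ((by linarith : 0 < a / 2).trans hb.1) p.1 p.2)).2
  · have e1 : ∀ b, ∫ y, -log (outMass μ b y) ∂outLaw μ b =
        ∫ p : E × E, -log (outMass μ b (p.1 + b⁻¹ • p.2)) ∂μ.prod (stdGaussian E) := by
      intro b
      rw [integral_neg, integral_neg, outLaw_eq_map, integral_map (by fun_prop)
        (measurable_log_outMass μ b).aestronglyMeasurable]
    -- Once differentiated, the integral returns to the joint law, where conditioning on the output
    -- is available.
    have e2 : ∫ p : E × E, a⁻¹ * (noiseSq μ a (p.1 + a⁻¹ • p.2) -
        inner ℝ p.2 (noiseMean μ a (p.1 + a⁻¹ • p.2))) ∂μ.prod (stdGaussian E) =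
        ∫ p : E × E, a⁻¹ * (noiseSq μ a p.2 -
          inner ℝ (a • (p.2 - p.1)) (noiseMean μ a p.2)) ∂jointLaw μ a := by
      rw [jointLaw, integral_map (by fun_prop) (Measurable.aestronglyMeasurable (by fun_prop))]
      congr with p
      simp [smul_smul, ha.ne']
    simp_rw [e1]
    rw [e2, integral_const_mul, integral_sub
      ((integrable_comp_snd_jointLaw_iff μ hm1.aestronglyMeasurable).2 (integrable_noiseSq μ ha))
      (integrable_inner_noise μ ha), integral_inner_noise μ ha,
      integral_comp_snd_jointLaw μ hm1.aestronglyMeasurable, integral_noiseSq μ ha] at hd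
    exact hd
  · have hb0 : 0 < b := (by linarith : 0 < a / 2).trans hb.1
    have h1 := abs_noiseSq_sub_inner_le μ b (p.1 + b⁻¹ • p.2) p.2
    have h2 := neg_log_outMass_line_le μ hb0 hb.2.le p.1 p.2
    have h3 := hb.1.le
    rw [norm_mul, norm_of_nonneg (by positivity), Real.norm_eq_abs]
    have h4 : |noiseSq μ b (p.1 + b⁻¹ • p.2) - inner ℝ p.2 (noiseMean μ b (p.1 + b⁻¹ • p.2))| ≤
        3 * -log (outMass μ (2 * a) (p.1 + (2 * a)⁻¹ • p.2)) + 2 * ‖p.2‖ ^ 2 := by linarith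
    gcongr

end GaussianChannelInformation

/-! ### Score, Fisher information and conditional mean. -/

noncomputable section GaussianChannelFisher

open Real Filter Topology

set_option linter.unusedSectionVars false

section Score

variable {E : Type*} [NormedAddCommGroup E] [InnerProductSpace ℝ E]
  [FiniteDimensional ℝ E] [MeasurableSpace E] [BorelSpace E]
  (μ : Measure E) [IsProbabilityMeasure μ]

lemma hasFDerivAt_exp_gaussExp (a : ℝ) (x y : E) :
    HasFDerivAt (fun y => rexp (gaussExp a x y))
      (innerSL ℝ (-a • rexp (gaussExp a x y) • a • (y - x))) y := by
  have h1 : HasFDerivAt (fun y : E => a • (y - x)) (a • ContinuousLinearMap.id ℝ E) y :=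
    ((hasFDerivAt_id y).sub_const x).const_smul a
  have h2 := (h1.norm_sq.const_mul (-1 / 2)).exp
  have e : (fun y => rexp (gaussExp a x y)) = fun y => rexp (-1 / 2 * ‖a • (y - x)‖ ^ 2) := by
    ext y
    rw [gaussExp]
    ring_nf
  rw [e]
  refine h2.congr_fderiv ?_
  ext v
  have : rexp (-1 / 2 * ‖a • (y - x)‖ ^ 2) = rexp (gaussExp a x y) := by
    rw [gaussExp]
    ring_nf
  simp [this]
  ring

lemma hasFDerivAt_outMass (a : ℝ) (y : E) :
    HasFDerivAt (outMass μ a)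
      (innerSL ℝ (-a • ∫ x, rexp (gaussExp a x y) • a • (y - x) ∂μ)) y := by
  have h := hasFDerivAt_integral_of_dominated_of_fderiv_le (𝕜 := ℝ) (μ := μ) (s := Set.univ)
    (F := fun y x => rexp (gaussExp a x y))
    (F' := fun y x => innerSL ℝ (-a • rexp (gaussExp a x y) • a • (y - x)))
    (x₀ := y) (bound := fun _ => |a| * 2) univ_mem
    (Eventually.of_forall fun y => by fun_prop) (integrable_exp_gaussExp μ a y)
    (by fun_prop) (ae_of_all _ fun x y _ => ?_)
    (integrable_const _) (ae_of_all _ fun x y _ => hasFDerivAt_exp_gaussExp a x y)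
  · have hi := (integrable_exp_smul_noise μ a y).smul (-a)
    refine h.congr_fderiv ?_
    rw [← integral_smul]
    exact (innerSL ℝ).integral_comp_comm hi
  · rw [innerSL_apply_norm, norm_smul, norm_neg, norm_smul (rexp _), norm_of_nonneg (exp_pos _).le,
      Real.norm_eq_abs]
    gcongr
    exact exp_mul_norm_le a x y

lemma contDiff_outMass (a : ℝ) : ContDiff ℝ 1 (outMass μ a) := by
  refine contDiff_one_iff_hasFDerivAt.2 ⟨_, ?_, hasFDerivAt_outMass μ a⟩
  have h : Continuous fun y => ∫ x, rexp (gaussExp a x y) • a • (y - x) ∂μ := by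
    refine continuous_of_dominated (bound := fun _ => 2) (fun y => by fun_prop)
      (fun y => ae_of_all _ fun x => ?_) (integrable_const _) (ae_of_all _ fun x => by fun_prop)
    rw [norm_smul, norm_of_nonneg (exp_pos _).le]
    exact exp_mul_norm_le a x y
  fun_prop

/-- Tweedie's formula: differentiating the kernel in `y` produces the factor -a · a(y - x), and
division by `outMass` makes its integral a posterior mean. -/
lemma gradient_log_outMass {c a : ℝ} (hc : 0 < c) (y : E) :
    gradient (fun u => log (c * outMass μ a u)) y = -(a • noiseMean μ a y) := by
  have hK := outMass_pos μ a y
  have h := ((hasFDerivAt_outMass μ a y).const_mul c).log (mul_pos hc hK).ne'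
  have h2 : HasGradientAt (fun u => log (c * outMass μ a u)) (-(a • noiseMean μ a y)) y := by
    rw [hasGradientAt_iff_hasFDerivAt]
    refine h.congr_fderiv ?_
    rw [noiseMean, integral_posterior]
    ext v
    simp
    field_simp
  exact h2.gradient

/-- Gibbs' inequality against the weight (1 + ‖y‖)^(-r): its logarithm grows so slowly that a first
moment of the output suffices. -/
lemma integrable_log_outMass_of_integrable_id {a : ℝ} (ha : 0 < a)
    (hμ : Integrable (fun x => x) μ) :
    Integrable (fun y => log (outMass μ a y)) (outLaw μ a) := by
  have h1 : Integrable (fun y => ‖y‖) (outLaw μ a) := by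
    rw [outLaw_eq_map, integrable_map_measure (by fun_prop) (by fun_prop)]
    exact ((hμ.comp_fst (stdGaussian E)).add ((IsGaussian.integrable_fun_id.comp_snd
      μ).smul a⁻¹)).norm
  rw [integrable_outLaw_iff μ ha] at h1 ⊢
  -- Any exponent above the dimension makes the weight integrable.
  set r : ℝ := Module.finrank ℝ E + 1 with hr
  have h2 : Integrable (fun y : E => (1 + ‖y‖) ^ (-r)) :=
    integrable_one_add_norm (by rw [hr]; linarith)
  have hm := measurable_log_outMass μ a
  refine ((h1.const_mul r).add (h2.const_mul (scaledConst E a))).mono'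
    (Measurable.aestronglyMeasurable (by fun_prop)) (ae_of_all _ fun y => ?_)
  have hD := scaledConst_pos (E := E) ha
  have hK := outMass_pos μ a y
  have hy : 0 < 1 + ‖y‖ := by positivity
  have hq : 0 < (1 + ‖y‖) ^ (-r) := rpow_pos_of_pos hy _
  rw [norm_smul, norm_of_nonneg (mul_pos hD hK).le, ← norm_neg (log _),
    norm_of_nonneg (neg_log_outMass_nonneg μ a y)]
  -- log u ≤ u - 1 at u = weight / `outMass`; multiplied by `outMass`, the quotient becomes the
  -- integrable weight.
  have h3 := log_le_sub_one_of_pos (div_pos hq hK)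
  rw [log_div hq.ne' hK.ne', log_rpow hy] at h3
  have h4 : log (1 + ‖y‖) ≤ ‖y‖ := by linarith [log_le_sub_one_of_pos hy]
  have h5 : r * log (1 + ‖y‖) ≤ r * ‖y‖ := by
    have : 0 ≤ r := by positivity
    gcongr
  have h6 : -log (outMass μ a y) ≤ (1 + ‖y‖) ^ (-r) / outMass μ a y + r * ‖y‖ := by linarith
  simp only [Pi.add_apply, smul_eq_mul]
  calc scaledConst E a * outMass μ a y * -log (outMass μ a y)
      ≤ scaledConst E a * outMass μ a y *
        ((1 + ‖y‖) ^ (-r) / outMass μ a y + r * ‖y‖) := by gcongr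
    _ = _ := by
      field_simp
      ring

lemma integrable_noise_jointLaw {a : ℝ} (ha : 0 < a) :
    Integrable (fun p : E × E => a • (p.2 - p.1)) (jointLaw μ a) := by
  have h : Integrable (fun z : E => z) (stdGaussian E) := IsGaussian.integrable_fun_id
  rw [← map_noise_jointLaw μ ha] at h
  exact h.comp_measurable (by fun_prop)

lemma integrable_noiseMean {a : ℝ} (ha : 0 < a) :
    Integrable (noiseMean μ a) (outLaw μ a) :=
  integrable_integral_posterior μ ha (integrable_noise_jointLaw μ ha)

/-- `noiseMean` is the conditional expectation of the normalized noise, given the output. -/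
lemma setIntegral_noise {a : ℝ} (ha : 0 < a) {A : Set E} (hA : MeasurableSet A) :
    ∫ p in Prod.snd ⁻¹' A, a • (p.2 - p.1) ∂jointLaw μ a =
      ∫ p in Prod.snd ⁻¹' A, noiseMean μ a p.2 ∂jointLaw μ a := by
  rw [← integral_indicator (measurable_snd hA), ← integral_indicator (measurable_snd hA),
    ← integral_integral_posterior μ ha
      ((integrable_noise_jointLaw μ ha).indicator (measurable_snd hA))]
  have e : (Prod.snd ⁻¹' A).indicator (fun p : E × E => noiseMean μ a p.2) =
      fun p => A.indicator (noiseMean μ a) p.2 := by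
    ext1 p
    by_cases hp : p.2 ∈ A
    · rw [Set.indicator_of_mem hp, Set.indicator_of_mem (by exact hp)]
    · rw [Set.indicator_of_notMem hp, Set.indicator_of_notMem (by exact hp)]
  rw [e, integral_comp_snd_jointLaw μ
    ((measurable_noiseMean μ a).indicator hA).aestronglyMeasurable]
  congr with y
  by_cases hy : y ∈ A <;> simp [Set.indicator, hy, noiseMean]

/-- Pythagoras: `integral_inner_noise` makes the cross term -2E‖m‖². -/
lemma integral_sq_noise_sub_noiseMean {a : ℝ} (ha : 0 < a) :
    ∫ p : E × E, ‖a • (p.2 - p.1) - noiseMean μ a p.2‖ ^ 2 ∂jointLaw μ a =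
      Module.finrank ℝ E - ∫ y, ‖noiseMean μ a y‖ ^ 2 ∂outLaw μ a := by
  have h1 := integrable_sq_noise μ ha
  have h2 := integrable_inner_noise μ ha
  have h3 := (integrable_comp_snd_jointLaw_iff μ (integrable_sq_noiseMean μ ha).1).2
    (integrable_sq_noiseMean μ ha)
  simp_rw [norm_sub_sq_real]
  rw [integral_add (by exact h1.sub (h2.const_mul 2)) h3, integral_sub h1 (h2.const_mul 2),
    integral_const_mul, integral_inner_noise μ ha, integral_sq_noise μ ha,
    integral_comp_snd_jointLaw μ (integrable_sq_noiseMean μ ha).1]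
  ring

lemma integrable_sq_noise_sub_noiseMean {a : ℝ} (ha : 0 < a) :
    Integrable (fun p : E × E => ‖a • (p.2 - p.1) - noiseMean μ a p.2‖ ^ 2) (jointLaw μ a) := by
  have h1 := integrable_sq_noise μ ha
  have h2 := integrable_inner_noise μ ha
  have h3 := (integrable_comp_snd_jointLaw_iff μ (integrable_sq_noiseMean μ ha).1).2
    (integrable_sq_noiseMean μ ha)
  simp_rw [norm_sub_sq_real]
  exact (h1.sub (h2.const_mul 2)).add h3

end Score

lemma lintegral_enorm_sq {α F : Type*} [MeasurableSpace α] [NormedAddCommGroup F]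
    {ν : Measure α} {f : α → F} (hf : Integrable (fun x => ‖f x‖ ^ 2) ν) :
    ∫⁻ x, ‖f x‖ₑ ^ 2 ∂ν = ENNReal.ofReal (∫ x, ‖f x‖ ^ 2 ∂ν) := by
  rw [ofReal_integral_eq_lintegral_ofReal hf (ae_of_all _ fun x => by positivity)]
  congr with x
  rw [ENNReal.ofReal_pow (norm_nonneg _), ofReal_norm]

variable {n : ℕ}

lemma IsContDensity.density_eq {ν : Measure (EuclideanSpace ℝ (Fin n))} [IsFiniteMeasure ν]
    {p : EuclideanSpace ℝ (Fin n) → ℝ} (hp : IsContDensity ν p) : density ν = p := by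
  have h : ∃ p, IsContDensity ν p := ⟨p, hp⟩
  rw [density, dif_pos h]
  exact h.choose_spec.unique hp

section Euclidean

variable (μ : Measure (EuclideanSpace ℝ (Fin n))) [IsProbabilityMeasure μ]

lemma isContDensity_outLaw {a : ℝ} (ha : 0 < a) :
    IsContDensity (outLaw μ a)
      (fun y => scaledConst (EuclideanSpace ℝ (Fin n)) a * outMass μ a y) :=
  ⟨continuous_const.mul (contDiff_outMass μ a).continuous,
    fun y => (mul_pos (scaledConst_pos ha) (outMass_pos μ a y)).le, outLaw_eq_withDensity μ ha⟩

lemma score_outLaw {a : ℝ} (ha : 0 < a) (y : EuclideanSpace ℝ (Fin n)) :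
    score (outLaw μ a) y = -(a • noiseMean μ a y) := by
  rw [score, (isContDensity_outLaw μ ha).density_eq]
  exact gradient_log_outMass μ (scaledConst_pos ha) y

lemma fisherInfo_outLaw {a : ℝ} (ha : 0 < a) :
    ∫⁻ y, ‖score (outLaw μ a) y‖ₑ ^ 2 ∂outLaw μ a =
      ENNReal.ofReal (a ^ 2 * ∫ y, ‖noiseMean μ a y‖ ^ 2 ∂outLaw μ a) := by
  have e : ∀ y, ‖-(a • noiseMean μ a y)‖ ^ 2 = a ^ 2 * ‖noiseMean μ a y‖ ^ 2 := fun y => by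
    rw [norm_neg, norm_smul, mul_pow, Real.norm_eq_abs, sq_abs]
  simp_rw [score_outLaw μ ha]
  rw [lintegral_enorm_sq]
  · simp_rw [e]
    rw [integral_const_mul]
  · simp_rw [e]
    exact (integrable_sq_noiseMean μ ha).const_mul _

end Euclidean

/-- Puts the noise at every time in terms of one standard Gaussian, which identifies the scale as
`(√t)⁻¹`. -/
lemma multivariateGaussian_zero_smul_one {t : ℝ} (ht : 0 < t) :
    multivariateGaussian 0 (t • (1 : Matrix (Fin n) (Fin n) ℝ)) =
      (stdGaussian (EuclideanSpace ℝ (Fin n))).map (fun z => √t • z) := by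
  have : IsProbabilityMeasure ((stdGaussian (EuclideanSpace ℝ (Fin n))).map (fun z => √t • z)) :=
    Measure.isProbabilityMeasure_map (by fun_prop)
  apply Measure.ext_of_charFun
  ext x
  rw [charFun_multivariateGaussian (Matrix.PosSemidef.one.smul ht.le), charFun_map_smul,
    charFun_stdGaussian, norm_smul, norm_of_nonneg (sqrt_nonneg t)]
  congr 1
  have h : x.ofLp ⬝ᵥ (t • (1 : Matrix (Fin n) (Fin n) ℝ)).mulVec x.ofLp = t * ‖x‖ ^ 2 := by
    rw [Matrix.smul_mulVec, Matrix.one_mulVec, dotProduct_smul, EuclideanSpace.real_norm_sq_eq,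
      smul_eq_mul]
    simp [dotProduct, sq]
  rw [h]
  push_cast
  rw [mul_pow, ← Complex.ofReal_pow (√t), sq_sqrt ht.le]
  simp
  ring

section Channel

variable {Ω : Type*} [MeasurableSpace Ω] {P : Measure Ω} [IsProbabilityMeasure P]
  {X Y Z : Ω → EuclideanSpace ℝ (Fin n)} {t : ℝ}

lemma map_prodMk_eq_jointLaw (hX : Measurable X) (hZ : Measurable Z) (ht : 0 < t)
    (hZlaw : P.map Z = multivariateGaussian 0 (t • (1 : Matrix (Fin n) (Fin n) ℝ)))
    (hind : IndepFun X Z P) (hY : ∀ ω, Y ω = X ω + Z ω) :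
    P.map (fun ω => (X ω, Y ω)) = jointLaw (P.map X) (√t)⁻¹ := by
  have := Measure.isProbabilityMeasure_map (μ := P) hX.aemeasurable
  have h1 := (indepFun_iff_map_prod_eq_prod_map_map hX.aemeasurable hZ.aemeasurable).1 hind
  have h2 : (fun ω => (X ω, Y ω)) = (fun p : EuclideanSpace ℝ (Fin n) ×
      EuclideanSpace ℝ (Fin n) => (p.1, p.1 + p.2)) ∘ fun ω => (X ω, Z ω) := by
    ext1 ω
    simp [hY]
  have h3 : (P.map X).prod ((stdGaussian (EuclideanSpace ℝ (Fin n))).map (fun z => √t • z)) =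
      ((P.map X).prod (stdGaussian (EuclideanSpace ℝ (Fin n)))).map
        (Prod.map id (fun z => √t • z)) := by
    rw [← Measure.map_prod_map _ _ measurable_id (by fun_prop), Measure.map_id]
  rw [h2, ← Measure.map_map (by fun_prop) (by fun_prop), h1, hZlaw,
    multivariateGaussian_zero_smul_one ht, h3, Measure.map_map (by fun_prop) (by fun_prop),
    jointLaw, inv_inv]
  rfl

lemma map_eq_outLaw {μ : Measure (EuclideanSpace ℝ (Fin n))} {a : ℝ}
    (hX : Measurable X) (hY : Measurable Y)
    (hJ : P.map (fun ω => (X ω, Y ω)) = jointLaw μ a) : P.map Y = outLaw μ a := by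
  rw [outLaw, ← hJ, Measure.map_map measurable_snd (by fun_prop)]
  rfl

/-- The conditional expectation of the input given the output of the Gaussian channel. -/
lemma condExp_eq_sub_noiseMean {μ : Measure (EuclideanSpace ℝ (Fin n))} [IsProbabilityMeasure μ]
    {a : ℝ} (ha : 0 < a) (hX : Measurable X) (hY : Measurable Y)
    (hJ : P.map (fun ω => (X ω, Y ω)) = jointLaw μ a) (hint : Integrable X P) :
    P[X | MeasurableSpace.comap Y inferInstance] =ᵐ[P]
      fun ω => Y ω - a⁻¹ • noiseMean μ a (Y ω) := by
  have hm : MeasurableSpace.comap Y inferInstance ≤ (inferInstance : MeasurableSpace Ω) :=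
    hY.comap_le
  have hXY : Measurable fun ω => (X ω, Y ω) := by fun_prop
  have hB := measurable_noiseMean μ a
  have hw : Integrable (fun ω => a • (Y ω - X ω)) P := by
    have := integrable_noise_jointLaw μ ha
    rw [← hJ] at this
    exact this.comp_measurable hXY
  have hBi : Integrable (fun ω => noiseMean μ a (Y ω)) P := by
    have := integrable_noiseMean μ ha
    rw [← map_eq_outLaw hX hY hJ] at this
    exact this.comp_measurable hY
  have hYi : Integrable Y P := by
    refine (hint.add (hw.smul a⁻¹)).congr (ae_of_all _ fun ω => ?_)
    simp [smul_smul, ha.ne']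
  refine (ae_eq_condExp_of_forall_setIntegral_eq hm hint
    (fun s _ _ => (hYi.sub (hBi.smul a⁻¹)).integrableOn) ?_ ?_).symm
  · rintro s ⟨A, hA, rfl⟩ -
    have h := setIntegral_noise μ ha hA
    rw [← hJ, setIntegral_map (measurable_snd hA) (by fun_prop) (by fun_prop),
      setIntegral_map (measurable_snd hA) (Measurable.aestronglyMeasurable (by fun_prop))
      (by fun_prop)] at h
    have h' : ∫ ω in Y ⁻¹' A, a • (Y ω - X ω) ∂P = ∫ ω in Y ⁻¹' A, noiseMean μ a (Y ω) ∂P := h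
    rw [integral_smul, integral_sub hYi.integrableOn hint.integrableOn] at h'
    simp only [Pi.sub_apply, Pi.smul_apply]
    rw [integral_sub hYi.integrableOn (by exact (hBi.smul a⁻¹).integrableOn),
      integral_smul, ← h', smul_smul, inv_mul_cancel₀ ha.ne', one_smul, sub_sub_cancel]
  · have hYc : Measurable[MeasurableSpace.comap Y inferInstance] Y := comap_measurable Y
    have h0 : Measurable fun y => y - a⁻¹ • noiseMean μ a y := by fun_prop
    exact (h0.comp hYc).stronglyMeasurable.aestronglyMeasurable

/-- The estimation error of the input is -a⁻¹ times that of the noise. It is therefore square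
integrable even if the input has no second moment. -/
lemma mmse_eq {μ : Measure (EuclideanSpace ℝ (Fin n))} [IsProbabilityMeasure μ]
    {a : ℝ} (ha : 0 < a) (hX : Measurable X) (hY : Measurable Y)
    (hJ : P.map (fun ω => (X ω, Y ω)) = jointLaw μ a) (hint : Integrable X P) :
    mmse X Y P = ENNReal.ofReal
      ((a⁻¹) ^ 2 * (n - ∫ y, ‖noiseMean μ a y‖ ^ 2 ∂outLaw μ a)) := by
  have hB := measurable_noiseMean μ a
  have h1 : mmse X Y P = ∫⁻ ω, ‖X ω - (Y ω - a⁻¹ • noiseMean μ a (Y ω))‖ₑ ^ 2 ∂P := by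
    refine lintegral_congr_ae ?_
    filter_upwards [condExp_eq_sub_noiseMean ha hX hY hJ hint] with ω hω
    rw [hω]
  have h2 : ∫⁻ ω, ‖X ω - (Y ω - a⁻¹ • noiseMean μ a (Y ω))‖ₑ ^ 2 ∂P =
      ∫⁻ p, ‖p.1 - (p.2 - a⁻¹ • noiseMean μ a p.2)‖ₑ ^ 2 ∂jointLaw μ a := by
    rw [← hJ, lintegral_map (by fun_prop) (by fun_prop)]
  have e : ∀ p : EuclideanSpace ℝ (Fin n) × EuclideanSpace ℝ (Fin n),
      ‖p.1 - (p.2 - a⁻¹ • noiseMean μ a p.2)‖ ^ 2 =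
        (a⁻¹) ^ 2 * ‖a • (p.2 - p.1) - noiseMean μ a p.2‖ ^ 2 := by
    intro p
    have : p.1 - (p.2 - a⁻¹ • noiseMean μ a p.2) =
        -(a⁻¹ • (a • (p.2 - p.1) - noiseMean μ a p.2)) := by
      rw [smul_sub, smul_smul, inv_mul_cancel₀ ha.ne', one_smul]
      abel
    rw [this, norm_neg, norm_smul, mul_pow, Real.norm_eq_abs, sq_abs]
  rw [h1, h2, lintegral_enorm_sq]
  · simp_rw [e]
    rw [integral_const_mul, integral_sq_noise_sub_noiseMean μ ha, finrank_euclideanSpace_fin]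
  · simp_rw [e]
    exact (integrable_sq_noise_sub_noiseMean μ ha).const_mul _

end Channel

end GaussianChannelFisher

/-! ### The theorem, by transfer to the channel at scale `(√t)⁻¹`. -/

theorem mainTheorem3 {Ω : Type*} [MeasurableSpace Ω] (P : Measure Ω) [IsProbabilityMeasure P]
    (n : ℕ) (X : Ω → EuclideanSpace ℝ (Fin n)) (hX : Measurable X)
    (Z : ℝ → Ω → EuclideanSpace ℝ (Fin n)) (hZ : ∀ t, 0 < t → Measurable (Z t))
    (hZlaw : ∀ t, 0 < t →
      P.map (Z t) = multivariateGaussian 0 (t • (1 : Matrix (Fin n) (Fin n) ℝ)))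
    (hind : ∀ t, 0 < t → IndepFun X (Z t) P)
    (Y : ℝ → Ω → EuclideanSpace ℝ (Fin n)) (hY : ∀ t ω, Y t ω = X ω + Z t ω) :
    -- the density of `Y t` is well defined, positive and C¹, and the Fisher information finite
    (∀ t, 0 < t → IsContDensity (P.map (Y t)) (density (P.map (Y t))) ∧
      ContDiff ℝ 1 (density (P.map (Y t))) ∧ (∀ y, 0 < density (P.map (Y t)) y) ∧
      fisherInfo (Y t) P ≠ ⊤) ∧
    -- the relation between mutual information and Fisher information
    ((∃ t₀, 0 < t₀ ∧ mutualInfo X (Y t₀) P ≠ ⊤) → ∀ t, 0 < t →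
      mutualInfo X (Y t) P ≠ ⊤ ∧
      HasDerivAt (fun s => (mutualInfo X (Y s) P).toReal)
        ((fisherInfo (Y t) P).toReal / 2 - n / (2 * t)) t) ∧
    -- integrable inputs: finite mutual information, and the MMSE-Fisher relation
    (Integrable X P → ∀ t, 0 < t →
      mutualInfo X (Y t) P ≠ ⊤ ∧ mmse X (Y t) P ≠ ⊤ ∧
      (mmse X (Y t) P).toReal = n * t - t ^ 2 * (fisherInfo (Y t) P).toReal) := by
  have hμ := Measure.isProbabilityMeasure_map (μ := P) hX.aemeasurable
  set μ := P.map X with hμdef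
  have ha : ∀ t : ℝ, 0 < t → 0 < (√t)⁻¹ := fun t ht => inv_pos.2 (Real.sqrt_pos.2 ht)
  have hYm : ∀ t, 0 < t → Measurable (Y t) := fun t ht => by
    have : Y t = fun ω => X ω + Z t ω := funext (hY t)
    rw [this]
    exact hX.add (hZ t ht)
  have hJ : ∀ t, 0 < t → P.map (fun ω => (X ω, Y t ω)) = jointLaw μ (√t)⁻¹ := fun t ht =>
    map_prodMk_eq_jointLaw hX (hZ t ht) ht (hZlaw t ht) (hind t ht) (hY t)
  have hL : ∀ t, 0 < t → P.map (Y t) = outLaw μ (√t)⁻¹ := fun t ht =>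
    map_eq_outLaw hX (hYm t ht) (hJ t ht)
  have hI : ∀ t, 0 < t → mutualInfo X (Y t) P =
      InformationTheory.klDiv (jointLaw μ (√t)⁻¹) (μ.prod (outLaw μ (√t)⁻¹)) := fun t ht => by
    rw [mutualInfo, hJ t ht, hL t ht]
  have hF : ∀ t, 0 < t → fisherInfo (Y t) P = ENNReal.ofReal
      (((√t)⁻¹) ^ 2 * ∫ y, ‖noiseMean μ (√t)⁻¹ y‖ ^ 2 ∂outLaw μ (√t)⁻¹) := fun t ht => by
    rw [fisherInfo, hL t ht, fisherInfo_outLaw μ (ha t ht)]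
  have hFr : ∀ t, 0 < t → (fisherInfo (Y t) P).toReal =
      t⁻¹ * ∫ y, ‖noiseMean μ (√t)⁻¹ y‖ ^ 2 ∂outLaw μ (√t)⁻¹ := fun t ht => by
    rw [hF t ht, ENNReal.toReal_ofReal (mul_nonneg (sq_nonneg _)
      (integral_nonneg fun _ => sq_nonneg _)), inv_pow, Real.sq_sqrt ht.le]
  refine ⟨fun t ht => ?_, ?_, fun hXi t ht => ⟨?_, ?_, ?_⟩⟩
  · have hd := isContDensity_outLaw μ (ha t ht)
    rw [hL t ht, hd.density_eq]
    refine ⟨hd, contDiff_const.mul (contDiff_outMass μ _),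
      fun y => mul_pos (scaledConst_pos (ha t ht)) (outMass_pos μ _ y), ?_⟩
    rw [hF t ht]
    exact ENNReal.ofReal_ne_top
  · rintro ⟨t₀, ht₀, h₀⟩
    rw [hI t₀ ht₀, klDiv_jointLaw_ne_top_iff μ (ha t₀ ht₀)] at h₀
    have hint : ∀ b, 0 < b → Integrable (fun y => Real.log (outMass μ b y)) (outLaw μ b) :=
      fun b hb => integrable_log_outMass_of_integrable μ (ha t₀ ht₀) hb h₀
    intro t ht
    refine ⟨by rw [hI t ht, klDiv_jointLaw_ne_top_iff μ (ha t ht)]; exact hint _ (ha t ht), ?_⟩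
    have hs : 0 < √t := Real.sqrt_pos.2 ht
    have h1 : HasDerivAt (fun s : ℝ => (√s)⁻¹) (-(1 / (2 * √t)) / √t ^ 2) t :=
      (Real.hasDerivAt_sqrt ht.ne').inv hs.ne'
    have h2 := ((hasDerivAt_integral_neg_log_outMass μ (ha t ht) hint).comp t h1).sub_const
      ((n : ℝ) / 2)
    -- The formula for the information is available only at positive times, hence equality near `t`
    -- rather than everywhere.
    refine (h2.congr_of_eventuallyEq ?_).congr_deriv ?_
    · filter_upwards [Ioi_mem_nhds ht] with s hs
      rw [hI s hs, toReal_klDiv_jointLaw μ (ha s hs) (hint _ (ha s hs)),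
        finrank_euclideanSpace_fin]
      rfl
    · rw [hFr t ht, finrank_euclideanSpace_fin, inv_inv, Real.sq_sqrt ht.le]
      -- Here J = S/t, and the chain rule gives √t(n - S) · (-t^(-3/2)/2) = S/(2t) - n/(2t).
      generalize ∫ y, ‖noiseMean μ (√t)⁻¹ y‖ ^ 2 ∂outLaw μ (√t)⁻¹ = S
      field_simp
      ring
  · rw [hI t ht, klDiv_jointLaw_ne_top_iff μ (ha t ht)]
    refine integrable_log_outMass_of_integrable_id μ (ha t ht) ?_
    rw [hμdef, integrable_map_measure (by fun_prop) (by fun_prop)]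
    exact hXi
  · rw [mmse_eq (ha t ht) hX (hYm t ht) (hJ t ht) hXi]
    exact ENNReal.ofReal_ne_top
  · rw [mmse_eq (ha t ht) hX (hYm t ht) (hJ t ht) hXi, hFr t ht, inv_inv, Real.sq_sqrt ht.le,
      ENNReal.toReal_ofReal]
    · field_simp
    -- `ENNReal.ofReal` truncates at 0; nonnegativity holds because n - E‖m‖² is a mean square
    -- error.
    · have h := integral_sq_noise_sub_noiseMean μ (ha t ht)
      rw [finrank_euclideanSpace_fin] at h
      rw [← h]
      exact mul_nonneg ht.le (integral_nonneg fun _ => sq_nonneg _)
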